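/- Let $G\subset\mathbb{C}$ be an open set, let $f$ be a meromorphic function on an open set $U$ containing the closure of $G$, and let $\epsilon\in(0,\infty)$. Let $\Lambda$ be a connected component of the level set $\{z\in U:|f(z)|=\epsilon\}$ which is bounded and contained in $G$. Regard $\Lambda$ as a planar graph: its vertices are the critical points of $f$ (the zeros of $f'$) lying in $\Lambda$, and its edges are the closures of the connected components of $\Lambda$ minus its vertices (so if $\Lambda$ has no vertices, its only edge is $\Lambda$ itself). The faces of $\Lambda$ are the connected components of $\mathbb{C}\setminus\Lambda$, and an edge is adjacent to a face if it is contained in the boundary of the face. Then $\Lambda$ has exactly one unbounded face and at least one bounded face, and every edge of $\Lambda$ is adjacent to exactly two distinct faces of $\Lambda$. -/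

import Mathlib

/-- The level set `{z ∈ U : |f z| = ε}` of a meromorphic function `f` with domain `U`, at a finite
positive height `ε`. A meromorphic function on `U` is represented by its normal form
(`MeromorphicNFOn f U`): `f` is analytic at every point of `U` that is not a pole, and takes the
default value `0` at poles. Hence for `0 < ε` poles (where `|f| = ∞`) are not in the level set. -/
def levelSet (U : Set ℂ) (f : ℂ → ℂ) (ε : ℝ) : Set ℂ :=
  {z | z ∈ U ∧ ‖f z‖ = ε}

/-- A level curve is a connected component of a level set. -/
def IsLevelCurve (U : Set ℂ) (f : ℂ → ℂ) (ε : ℝ) (L : Set ℂ) : Prop :=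
  ∃ z ∈ levelSet U f ε, L = connectedComponentIn (levelSet U f ε) z

/-- The vertices of a level curve `L` of `f`: the critical points of `f` lying in `L`. -/
def levelCurveVertices (f : ℂ → ℂ) (L : Set ℂ) : Set ℂ :=
  {z | z ∈ L ∧ deriv f z = 0}

/-- The edges of a level curve `L` of `f`, as point sets containing their end points: an edge is
obtained by removing the vertices from `L`, taking a connected component, and adding its end points
by closing up. If `L` has no vertices (`L` is a simple closed path), its only edge is `L` itself. -/
def IsLevelCurveEdge (f : ℂ → ℂ) (L e : Set ℂ) : Prop :=
  ∃ z ∈ L \ levelCurveVertices f L,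
    e = closure (connectedComponentIn (L \ levelCurveVertices f L) z)

/-- The faces of a plane set `L`: the connected components of its complement in `ℂ`. -/
def IsFace (L F : Set ℂ) : Prop :=
  ∃ z ∈ Lᶜ, F = connectedComponentIn Lᶜ z

/-- An edge is adjacent to a face if it is contained in the boundary of the face. -/
def IsAdjacent (e F : Set ℂ) : Prop :=
  e ⊆ frontier F

section

open Set Filter Topology


/-! Everything rests on the sign of `|f| - ε` near `L`. The compact set `L` has a connected open
neighbourhood `N` in which `|f| = ε` only on `L` (`IsLevelCurve.exists_isOpen_superset`). For a face
`F` of `L`, unicoherence of the plane makes `F ∩ N` connected (`IsFace.isPreconnected_inter`), so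
`|f| - ε` has constant sign there (`IsLevelCurve.face_one_sided`).

Near every point of `L` both signs occur, because `f` is locally a nonzero constant times `exp (w ^
k)` in a suitable coordinate `w`. Hence there are at least two faces, and since only one is
unbounded, another is bounded. At a noncritical point `k = 1`: the two sides are half discs, so
exactly two faces meet there, and they are distinct because their signs differ. Adjacency to these
faces then propagates along the connected edge. -/

/-! ### Unicoherence. -/

/-- A continuous logarithm of the constant `1` is constant on every preconnected set. -/
theorem IsPreconnected.eq_of_exp_eq_one {X : Type*} [TopologicalSpace X] {s : Set X}
    (hs : IsPreconnected s) {h : X → ℂ} (hc : ContinuousOn h s)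
    (h1 : ∀ x ∈ s, Complex.exp (h x) = 1) {x y : X} (hx : x ∈ s) (hy : y ∈ s) : h x = h y := by
  have hpi : (2 * Real.pi * Complex.I : ℂ) ≠ 0 := Complex.two_pi_I_ne_zero
  have key : ∀ x ∈ s, ∃ n : ℤ, h x / (2 * Real.pi * Complex.I) = n := fun x hx ↦ by
    obtain ⟨n, hn⟩ := Complex.exp_eq_one_iff.1 (h1 x hx)
    exact ⟨n, by rw [hn, mul_div_cancel_right₀ _ hpi]⟩
  have hre : ∀ x ∈ s, ((round (h x / (2 * Real.pi * Complex.I)).re : ℤ) : ℂ)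
      = h x / (2 * Real.pi * Complex.I) := fun x hx ↦ by
    obtain ⟨n, hn⟩ := key x hx
    rw [hn]; simp
  have hcont : ContinuousOn (fun x ↦ (h x / (2 * Real.pi * Complex.I)).re) s :=
    Complex.continuous_re.comp_continuousOn (hc.div_const _)
  have hd : (h x / (2 * Real.pi * Complex.I)).re = (h y / (2 * Real.pi * Complex.I)).re := by
    refine hs.constant_of_mapsTo (T := range ((↑) : ℤ → ℝ)) ?_ hcont ?_ hx hy
    · rw [← image_univ]
      exact IsDiscrete.univ.image Int.isClosedEmbedding_coe_real.isInducing
    · intro z hz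
      obtain ⟨n, hn⟩ := key z hz
      exact ⟨n, by simp [hn]⟩
  have := hre x hx
  rw [hd, hre y hy] at this
  exact (div_left_inj' hpi).1 this.symm

/-- Unicoherence: in a simply connected space, two connected open sets covering the space have
connected intersection. -/
theorem IsPreconnected.inter_of_union_eq_univ {X : Type*} [TopologicalSpace X] [NormalSpace X]
    [SimplyConnectedSpace X] [LocallyPathConnectedSpace X] {A B : Set X} (hA : IsPreconnected A)
    (hB : IsPreconnected B) (hAo : IsOpen A) (hBo : IsOpen B) (hAB : A ∪ B = univ) :
    IsPreconnected (A ∩ B) := by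
  classical
  rintro u v hu hv huv ⟨p, hpAB, hpu⟩ ⟨q, hqAB, hqv⟩
  by_contra hne
  rw [not_nonempty_iff_eq_empty] at hne
  have hdis : ∀ x ∈ A ∩ B, x ∈ u → x ∉ v := fun x hx h1 h2 ↦ by
    have : x ∈ A ∩ B ∩ (u ∩ v) := ⟨hx, h1, h2⟩
    rwa [hne] at this
  set P := A ∩ B ∩ u with hP
  have hPo : IsOpen P := (hAo.inter hBo).inter hu
  have hfr : ∀ x ∈ frontier P, x ∈ A ∩ B → False := fun x hx hxAB ↦ by
    rw [hPo.frontier_eq] at hx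
    rcases huv hxAB with h | h
    · exact hx.2 ⟨hxAB, h⟩
    · obtain ⟨y, ⟨hy1, hy2⟩, hy3⟩ :=
        mem_closure_iff.1 hx.1 _ ((hAo.inter hBo).inter hv) ⟨hxAB, h⟩
      exact hdis y hy1 hy3.2 hy2
  obtain ⟨φ, hφ0, hφ1, -⟩ := exists_continuous_zero_one_of_isClosed (s := Aᶜ) (t := Bᶜ)
    hAo.isClosed_compl hBo.isClosed_compl (by
      rw [disjoint_compl_left_iff_subset]
      intro x hx
      exact (hAB ▸ mem_univ x : x ∈ A ∪ B).resolve_right hx)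
  set c : ℂ := 2 * Real.pi * Complex.I with hc
  have hec : Complex.exp c = 1 := Complex.exp_two_pi_mul_I
  have hφc : Continuous fun x ↦ ((φ x : ℝ) : ℂ) := Complex.continuous_ofReal.comp φ.continuous
  -- `P` has no frontier point in `A ∩ B`, and elsewhere `φ` is 0 or 1, so `g` is continuous. It has
  -- a global logarithm `θ`, a logarithm `a` on `A` and a logarithm `b` on `B`; comparing them at `p
  -- ∈ P` and `q ∉ P` would force `2πi = 0`.
  let g : X → ℂ := P.piecewise (fun x ↦ Complex.exp (c * φ x)) 1
  have hg : Continuous g := by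
    refine continuous_piecewise ?_ (by fun_prop) continuous_one.continuousOn
    intro x hx
    by_cases hxA : x ∈ A
    · have : φ x = 1 := hφ1 fun hxB ↦ hfr x hx ⟨hxA, hxB⟩
      simp [this, hec]
    · have : φ x = 0 := hφ0 hxA
      simp [this]
  have hg0 : ∀ x, g x ≠ 0 := fun x ↦ by
    by_cases hxP : x ∈ P <;> simp [g, hxP]
  obtain ⟨θ, ⟨-, hθ⟩, -⟩ := Complex.isCoveringMapOn_exp.existsUnique_continuousMap_lifts
    ⟨g, hg⟩ (Complex.exp_log (hg0 p)) hg0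
  have hθ' : ∀ x, Complex.exp (θ x) = g x := fun x ↦ congrFun hθ x
  let a : X → ℂ := P.piecewise (fun x ↦ c * φ x - c) 0
  let b : X → ℂ := P.piecewise (fun x ↦ c * φ x) 0
  have ha : ContinuousOn a A := by
    refine ContinuousOn.piecewise ?_ (by fun_prop) continuousOn_const
    rintro x ⟨hxA, hx⟩
    have : φ x = 1 := hφ1 fun hxB ↦ hfr x hx ⟨hxA, hxB⟩
    simp [this]
  have hb : ContinuousOn b B := by
    refine ContinuousOn.piecewise ?_ (by fun_prop) continuousOn_const
    rintro x ⟨hxB, hx⟩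
    have : φ x = 0 := hφ0 fun hxA ↦ hfr x hx ⟨hxA, hxB⟩
    simp [this]
  have hea : ∀ x, Complex.exp (θ x - a x) = 1 := fun x ↦ by
    rw [Complex.exp_sub, hθ', div_eq_one_iff_eq (Complex.exp_ne_zero _)]
    by_cases hxP : x ∈ P <;> simp [g, a, hxP, Complex.exp_sub, hec]
  have heb : ∀ x, Complex.exp (θ x - b x) = 1 := fun x ↦ by
    rw [Complex.exp_sub, hθ', div_eq_one_iff_eq (Complex.exp_ne_zero _)]
    by_cases hxP : x ∈ P <;> simp [g, b, hxP]
  have h1 := hA.eq_of_exp_eq_one (θ.continuous.continuousOn.sub ha) (fun x _ ↦ hea x)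
    hpAB.1 hqAB.1
  have h2 := hB.eq_of_exp_eq_one (θ.continuous.continuousOn.sub hb) (fun x _ ↦ heb x)
    hpAB.2 hqAB.2
  have hpP : p ∈ P := ⟨hpAB, hpu⟩
  have hqP : q ∉ P := fun h ↦ hdis q hqAB h.2 hqv
  simp only [a, b, Pi.sub_apply, hpP, hqP, piecewise_eq_of_mem, piecewise_eq_of_notMem,
    not_false_eq_true, Pi.zero_apply] at h1 h2
  apply Complex.two_pi_I_ne_zero
  linear_combination h1 - h2

/-! ### Faces of a closed plane set. -/

theorem IsFace.isOpen {L F : Set ℂ} (hL : IsClosed L) (hF : IsFace L F) : IsOpen F := by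
  obtain ⟨z, -, rfl⟩ := hF
  exact hL.isOpen_compl.connectedComponentIn

theorem IsFace.isPreconnected {L F : Set ℂ} (hF : IsFace L F) : IsPreconnected F := by
  obtain ⟨z, -, rfl⟩ := hF
  exact isPreconnected_connectedComponentIn

theorem IsFace.nonempty {L F : Set ℂ} (hF : IsFace L F) : F.Nonempty := by
  obtain ⟨z, hz, rfl⟩ := hF
  exact ⟨z, mem_connectedComponentIn hz⟩

theorem IsFace.subset_compl {L F : Set ℂ} (hF : IsFace L F) : F ⊆ Lᶜ := by
  obtain ⟨z, hz, rfl⟩ := hF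
  exact connectedComponentIn_subset _ _

/-- A face contains every connected subset of the complement that it meets. -/
theorem IsFace.subset_of_inter_nonempty {L F S : Set ℂ} (hF : IsFace L F) (hS : IsPreconnected S)
    (hSL : S ⊆ Lᶜ) (h : (F ∩ S).Nonempty) : S ⊆ F := by
  obtain ⟨z, hz, rfl⟩ := hF
  obtain ⟨y, hy, hyS⟩ := h
  rw [connectedComponentIn_eq hy]
  exact hS.subset_connectedComponentIn hyS hSL

theorem IsFace.eq_of_inter_nonempty {L F F' : Set ℂ} (hF : IsFace L F) (hF' : IsFace L F')
    (h : (F ∩ F').Nonempty) : F = F' :=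
  (hF'.subset_of_inter_nonempty hF.isPreconnected hF.subset_compl (by rwa [inter_comm])).antisymm
    (hF.subset_of_inter_nonempty hF'.isPreconnected hF'.subset_compl h)

theorem exists_isFace_mem {L : Set ℂ} {z : ℂ} (hz : z ∈ Lᶜ) : ∃ F, IsFace L F ∧ z ∈ F :=
  ⟨_, ⟨z, hz, rfl⟩, mem_connectedComponentIn hz⟩

theorem IsFace.frontier_subset {L F : Set ℂ} (hL : IsClosed L) (hF : IsFace L F) :
    frontier F ⊆ L := by
  intro x hx
  by_contra hxL
  obtain ⟨F', hF', hxF'⟩ := exists_isFace_mem (L := L) hxL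
  rw [(hF.isOpen hL).frontier_eq] at hx
  obtain ⟨y, hy⟩ := mem_closure_iff.1 hx.1 F' (hF'.isOpen hL) hxF'
  rw [hF'.eq_of_inter_nonempty hF ⟨y, hy⟩] at hxF'
  exact hx.2 hxF'

/-- The plane is connected, so a nonempty proper subset has a frontier point. -/
theorem IsFace.closure_inter_nonempty {L F : Set ℂ} (hL : IsClosed L) (hLne : L.Nonempty)
    (hF : IsFace L F) : (closure F ∩ L).Nonempty := by
  have : (frontier F).Nonempty := by
    rw [nonempty_frontier_iff]
    refine ⟨hF.nonempty, fun h ↦ ?_⟩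
    obtain ⟨x, hx⟩ := hLne
    exact hF.subset_compl (h ▸ mem_univ x) hx
  obtain ⟨x, hx⟩ := this
  exact ⟨x, frontier_subset_closure hx, hF.frontier_subset hL hx⟩

/-- Near a connected closed set, each of its faces is connected. -/
theorem IsFace.isPreconnected_inter {L F N : Set ℂ} (hL : IsClosed L) (hLne : L.Nonempty)
    (hF : IsFace L F) (hN : IsPreconnected N) (hNo : IsOpen N) (hLN : L ⊆ N) :
    IsPreconnected (F ∩ N) := by
  have hV : N ∪ Fᶜ = N ∪ ⋃ F' ∈ {F' | IsFace L F' ∧ F' ≠ F}, F' := by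
    ext x
    by_cases hxN : x ∈ N
    · simp [hxN]
    · simp only [mem_union, hxN, false_or, mem_compl_iff, mem_iUnion, mem_ofPred_eq, exists_prop]
      constructor
      · intro hxF
        obtain ⟨F', hF', hxF'⟩ := exists_isFace_mem (L := L) (fun h ↦ hxN (hLN h))
        exact ⟨F', ⟨hF', fun h ↦ hxF (h ▸ hxF')⟩, hxF'⟩
      · rintro ⟨F', ⟨hF', hne⟩, hxF'⟩ hxF
        exact hne (hF'.eq_of_inter_nonempty hF ⟨x, hxF', hxF⟩)
  have hVo : IsOpen (N ∪ Fᶜ) := by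
    rw [hV]
    exact hNo.union (isOpen_biUnion fun F' h ↦ h.1.isOpen hL)
  have hVc : IsPreconnected (N ∪ Fᶜ) := by
    obtain ⟨p, hp⟩ := id hLne
    refine isPreconnected_of_forall p fun y hy ↦ ?_
    by_cases hyN : y ∈ N
    · exact ⟨N, subset_union_left, hLN hp, hyN, hN⟩
    obtain ⟨F', hF', hyF'⟩ := exists_isFace_mem (L := L) fun h ↦ hyN (hLN h)
    -- Adding the boundary point `q ∈ L ⊆ N` to `F'` keeps it connected and makes it meet `N`.
    obtain ⟨q, hq, hqL⟩ := hF'.closure_inter_nonempty hL hLne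
    refine ⟨N ∪ insert q F', ?_, .inl (hLN hp), .inr (.inr hyF'), hN.union q (hLN hqL)
      (mem_insert _ _) (hF'.isPreconnected.subset_closure (subset_insert _ _)
        (insert_subset hq subset_closure))⟩
    refine union_subset_union_right _ (insert_subset (fun h ↦ hF.subset_compl h hqL) ?_)
    intro x hx hxF
    exact hy.resolve_left hyN (hF'.eq_of_inter_nonempty hF ⟨x, hx, hxF⟩ ▸ hyF')
  have h := hF.isPreconnected.inter_of_union_eq_univ hVc (hF.isOpen hL) hVo (by
    ext x; by_cases hx : x ∈ F <;> simp [hx])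
  have e : F ∩ (N ∪ Fᶜ) = F ∩ N := by ext x; by_cases hx : x ∈ F <;> simp [hx]
  rwa [e] at h

/-- The exterior of a large disc is connected and misses `L`, so it lies in a single face; all other
faces lie in the disc. -/
theorem existsUnique_isFace_not_isBounded {L : Set ℂ} (hL : Bornology.IsBounded L) :
    ∃! F : Set ℂ, IsFace L F ∧ ¬ Bornology.IsBounded F := by
  obtain ⟨R, hR0, hR⟩ : ∃ R, 0 < R ∧ L ⊆ Metric.closedBall 0 R := by
    obtain ⟨R, hR⟩ := hL.subset_closedBall 0
    exact ⟨max R 1, by positivity, hR.trans (Metric.closedBall_subset_closedBall (le_max_left _ _))⟩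
  have hconn : IsPreconnected (Metric.closedBall (0 : ℂ) R)ᶜ := by
    have : (Metric.closedBall (0 : ℂ) R)ᶜ
        = (fun p : ℂ × ℝ ↦ p.2 • p.1) '' (Metric.sphere 0 1 ×ˢ Ioi R) := by
      ext z
      simp only [mem_compl_iff, Metric.mem_closedBall, dist_zero_right, not_le, mem_image,
        mem_prod, mem_sphere_iff_norm, sub_zero, mem_Ioi, Prod.exists]
      constructor
      · intro hz
        have hz0 : z ≠ 0 := by rintro rfl; simp at hz; linarith
        refine ⟨(‖z‖⁻¹ : ℝ) • z, ‖z‖, ⟨?_, hz⟩, ?_⟩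
        · simp [hz0]
        · rw [smul_smul, mul_inv_cancel₀ (norm_ne_zero_iff.2 hz0), one_smul]
      · rintro ⟨w, r, ⟨hw, hr⟩, rfl⟩
        rw [norm_smul, hw, Real.norm_of_nonneg (by linarith)]
        linarith
    rw [this]
    refine IsPreconnected.image ?_ _ (by fun_prop)
    exact (isPreconnected_sphere (by simp) _ _).prod isPreconnected_Ioi
  have hsub : (Metric.closedBall (0 : ℂ) R)ᶜ ⊆ Lᶜ := compl_subset_compl.2 hR
  obtain ⟨F, hF, hRF⟩ := exists_isFace_mem (L := L) (z := ((R + 1 : ℝ) : ℂ)) (hsub (by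
    simp only [mem_compl_iff, Metric.mem_closedBall, dist_zero_right, not_le, Complex.norm_real]
    rw [Real.norm_of_nonneg] <;> linarith))
  have hFs : (Metric.closedBall (0 : ℂ) R)ᶜ ⊆ F := by
    refine hF.subset_of_inter_nonempty hconn hsub ⟨_, hRF, ?_⟩
    simp only [mem_compl_iff, Metric.mem_closedBall, dist_zero_right, not_le, Complex.norm_real]
    rw [Real.norm_of_nonneg] <;> linarith
  refine ⟨F, ⟨hF, fun hb ↦ ?_⟩, ?_⟩
  · have : Bornology.IsBounded (univ : Set ℂ) := by
      rw [← compl_union_self (Metric.closedBall (0 : ℂ) R)]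
      exact (hb.subset hFs).union Metric.isBounded_closedBall
    exact NormedSpace.unbounded_univ ℝ ℂ this
  · rintro F' ⟨hF', hb'⟩
    by_contra hne
    refine hb' (Metric.isBounded_closedBall (x := (0 : ℂ)) (r := R) |>.subset ?_)
    intro x hx
    by_contra hxR
    exact hne (hF'.eq_of_inter_nonempty hF ⟨x, hx, hFs hxR⟩)

/-! ### Local structure of a level set. -/

/-- Local form of a nonconstant analytic function near a point where it does not vanish: up to a
local homeomorphism it is `z ↦ exp (z ^ k)`. -/
theorem AnalyticAt.exists_openPartialHomeomorph_exp_pow {f : ℂ → ℂ} {z₀ : ℂ}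
    (hf : AnalyticAt ℂ f z₀) (hf0 : f z₀ ≠ 0) (hnc : ¬ ∀ᶠ z in 𝓝 z₀, f z = f z₀) :
    ∃ (k : ℕ) (h : OpenPartialHomeomorph ℂ ℂ), k ≠ 0 ∧ z₀ ∈ h.source ∧ h z₀ = 0 ∧
      (deriv f z₀ ≠ 0 → k = 1) ∧ ∀ z ∈ h.source, f z = f z₀ * Complex.exp (h z ^ k) := by
  have hq : AnalyticAt ℂ (fun z ↦ f z / f z₀) z₀ := hf.div analyticAt_const hf0
  have hg : AnalyticAt ℂ (fun z ↦ Complex.log (f z / f z₀)) z₀ :=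
    hq.clog (by simp [div_self hf0])
  have hge : ∀ᶠ z in 𝓝 z₀, f z = f z₀ * Complex.exp (Complex.log (f z / f z₀)) := by
    filter_upwards [hf.continuousAt.eventually_ne hf0] with z hz
    rw [Complex.exp_log (div_ne_zero hz hf0), mul_div_cancel₀ _ hf0]
  have htop : analyticOrderAt (fun z ↦ Complex.log (f z / f z₀)) z₀ ≠ ⊤ := fun h ↦ by
    rw [analyticOrderAt_eq_top] at h
    refine hnc ?_
    filter_upwards [h, hge] with z h1 h2
    rw [h2, h1, Complex.exp_zero, mul_one]
  obtain ⟨u, hu, hu0, hgu⟩ := hg.analyticOrderAt_ne_top.1 htop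
  set k := analyticOrderNatAt (fun z ↦ Complex.log (f z / f z₀)) z₀
  have hk : k ≠ 0 := fun hk ↦ by
    have := hgu.self_of_nhds
    simp [hk, div_self hf0] at this
    exact hu0 this.symm
  obtain ⟨r, hr⟩ := IsAlgClosed.exists_pow_nat_eq (u z₀) (Nat.pos_of_ne_zero hk)
  have hr0 : r ≠ 0 := by
    rintro rfl
    rw [zero_pow hk] at hr
    exact hu0 hr.symm
  -- An analytic `k`-th root of `u`: the principal logarithm is applied only near 1. The coordinate
  -- is then `p = (z - z₀) * v`.
  let v : ℂ → ℂ := fun z ↦ r * Complex.exp (Complex.log (u z / u z₀) / k)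
  have hv : AnalyticAt ℂ v z₀ := by
    have h1 : AnalyticAt ℂ (fun z ↦ Complex.log (u z / u z₀)) z₀ :=
      (hu.div analyticAt_const hu0).clog (by simp [div_self hu0])
    exact analyticAt_const.mul (h1.div analyticAt_const (by exact_mod_cast hk)).cexp
  have hv0 : v z₀ = r := by simp [v, div_self hu0]
  have hvk : ∀ᶠ z in 𝓝 z₀, v z ^ k = u z := by
    filter_upwards [hu.continuousAt.eventually_ne hu0] with z hz
    rw [mul_pow, ← Complex.exp_nat_mul, mul_div_cancel₀ _ (by exact_mod_cast hk),
      Complex.exp_log (div_ne_zero hz hu0), hr, mul_div_cancel₀ _ hu0]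
  let p : ℂ → ℂ := fun z ↦ (z - z₀) * v z
  have hp : AnalyticAt ℂ p z₀ := (analyticAt_id.sub analyticAt_const).mul hv
  have hpd : HasStrictDerivAt p r z₀ := by
    have h1 : HasDerivAt p (1 * v z₀ + (z₀ - z₀) * deriv v z₀) z₀ :=
      ((hasDerivAt_id z₀).sub_const z₀).mul hv.differentiableAt.hasDerivAt
    have h2 := hp.hasStrictDerivAt
    rw [h1.deriv, hv0] at h2
    simpa using h2
  have hfp : ∀ᶠ z in 𝓝 z₀, f z = f z₀ * Complex.exp (p z ^ k) := by
    filter_upwards [hge, hgu, hvk] with z h1 h2 h3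
    rw [h1, h2]
    simp only [p, smul_eq_mul, mul_pow, h3]
  have hp0 : p z₀ = 0 := by simp [p]
  let H := (hpd.hasStrictFDerivAt_equiv hr0).toOpenPartialHomeomorph p
  obtain ⟨S, hS, hSo, hSz⟩ := eventually_nhds_iff.1 hfp
  refine ⟨k, H.restrOpen S hSo, hk, ?_, hp0, ?_, ?_⟩
  · exact ⟨(hpd.hasStrictFDerivAt_equiv hr0).mem_toOpenPartialHomeomorph_source, hSz⟩
  · intro hd
    by_contra hk1
    refine hd ?_
    rw [EventuallyEq.deriv_eq hfp]
    have h1 : HasDerivAt (fun z ↦ f z₀ * Complex.exp (p z ^ k)) _ z₀ :=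
      ((hpd.hasDerivAt.pow k).cexp).const_mul (f z₀)
    rw [h1.deriv, hp0, zero_pow (by omega : k - 1 ≠ 0)]
    simp
  · intro z hz
    exact hS z hz.2

/-- Small neighbourhoods of a point of a level set meet the level set in a connected set, and
meet both sides of it; at a noncritical point the two sides are connected. -/
theorem AnalyticAt.exists_nhds_level {f : ℂ → ℂ} {z₀ : ℂ} {ε : ℝ} (hε : 0 < ε)
    (hf : AnalyticAt ℂ f z₀) (hf0 : ‖f z₀‖ = ε) (hnc : ¬ ∀ᶠ z in 𝓝 z₀, f z = f z₀)
    {W : Set ℂ} (hW : W ∈ 𝓝 z₀) :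
    ∃ N, IsOpen N ∧ z₀ ∈ N ∧ N ⊆ W ∧ IsPreconnected N ∧ IsPreconnected (N ∩ {z | ‖f z‖ = ε}) ∧
      (N ∩ {z | ‖f z‖ < ε}).Nonempty ∧ (N ∩ {z | ε < ‖f z‖}).Nonempty ∧
      (deriv f z₀ ≠ 0 → IsPreconnected (N ∩ {z | ‖f z‖ < ε}) ∧
        IsPreconnected (N ∩ {z | ε < ‖f z‖})) := by
  obtain ⟨k, h, hk, hz, h0, hk1, hfh⟩ := hf.exists_openPartialHomeomorph_exp_pow
    (by rw [← norm_pos_iff, hf0]; exact hε) hnc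
  have hsymm0 : h.symm 0 = z₀ := by rw [← h0, h.left_inv hz]
  have ht0 : (0 : ℂ) ∈ h.target := h0 ▸ h.map_source hz
  obtain ⟨r, hr, hball⟩ : ∃ r > 0, Metric.ball (0 : ℂ) r ⊆ h.target ∩ h.symm ⁻¹' W := by
    refine Metric.mem_nhds_iff.1 (inter_mem (h.open_target.mem_nhds ht0) ?_)
    exact (h.continuousAt_symm ht0) (by rwa [hsymm0])
  have hnorm : ∀ w ∈ Metric.ball (0 : ℂ) r, ‖f (h.symm w)‖ = ε * Real.exp (w ^ k).re := by
    intro w hw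
    have hwt := (hball hw).1
    rw [hfh _ (h.map_target hwt), norm_mul, hf0, h.right_inv hwt, Complex.norm_exp]
  set N := h.symm '' Metric.ball (0 : ℂ) r with hN
  have hcont : ContinuousOn h.symm (Metric.ball (0 : ℂ) r) :=
    h.continuousOn_symm.mono fun w hw ↦ (hball hw).1
  have hinter : ∀ P : ℝ → Prop, N ∩ {z | P ‖f z‖}
      = h.symm '' (Metric.ball 0 r ∩ {w | P (ε * Real.exp (w ^ k).re)}) := by
    intro P
    ext z
    constructor
    · rintro ⟨⟨w, hw, rfl⟩, hP⟩
      exact ⟨w, ⟨hw, by rw [mem_ofPred_eq, ← hnorm w hw]; exact hP⟩, rfl⟩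
    · rintro ⟨w, ⟨hw, hP⟩, rfl⟩
      exact ⟨⟨w, hw, rfl⟩, by rw [mem_ofPred_eq, hnorm w hw]; exact hP⟩
  have himg : ∀ {S : Set ℂ}, IsPreconnected (Metric.ball 0 r ∩ S) →
      IsPreconnected (h.symm '' (Metric.ball 0 r ∩ S)) := fun hS ↦
    hS.image _ (hcont.mono inter_subset_left)
  have hlt : ∀ x : ℝ, ε * Real.exp x < ε ↔ x < 0 := fun x ↦ by
    rw [mul_lt_iff_lt_one_right hε, Real.exp_lt_one_iff]
  have hgt : ∀ x : ℝ, ε < ε * Real.exp x ↔ 0 < x := fun x ↦ by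
    rw [lt_mul_iff_one_lt_right hε, Real.one_lt_exp_iff]
  have heq : ∀ x : ℝ, ε * Real.exp x = ε ↔ x = 0 := fun x ↦ by
    rw [mul_eq_left₀ hε.ne', Real.exp_eq_one_iff]
  refine ⟨N, ?_, ⟨0, Metric.mem_ball_self hr, hsymm0⟩, ?_, ?_, ?_, ?_, ?_, ?_⟩
  · exact h.symm.isOpen_image_of_subset_source Metric.isOpen_ball fun w hw ↦ (hball hw).1
  · rintro _ ⟨w, hw, rfl⟩
    exact (hball hw).2
  · exact (convex_ball _ _).isPreconnected.image _ hcont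
  · rw [hinter (· = ε)]
    apply himg
    simp only [heq]
    have h0S : (0 : ℂ) ∈ Metric.ball (0 : ℂ) r ∩ {w | (w ^ k).re = 0} :=
      ⟨Metric.mem_ball_self hr, by simp [zero_pow hk]⟩
    -- The set is star-shaped about 0, since `(t w) ^ k = t ^ k * w ^ k` for real `t`.
    refine isPreconnected_of_forall 0 fun w hw ↦ ⟨segment ℝ 0 w, ?_, left_mem_segment _ _ _,
      right_mem_segment _ _ _, (convex_segment _ _).isPreconnected⟩
    intro x hx
    refine ⟨(convex_ball _ _).segment_subset h0S.1 hw.1 hx, ?_⟩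
    rw [segment_eq_image] at hx
    obtain ⟨t, -, rfl⟩ := hx
    have := hw.2
    simp only [mem_ofPred_eq] at this ⊢
    simp only [smul_zero, zero_add, smul_pow, Complex.smul_re, this]
  · rw [hinter (· < ε)]
    refine Nonempty.image _ ?_
    simp only [hlt]
    -- A `k`-th root of a negative real number, whose modulus `r / 2` keeps it in the ball.
    obtain ⟨w, hw⟩ := IsAlgClosed.exists_pow_nat_eq (-((r / 2) ^ k : ℝ) : ℂ)
      (Nat.pos_of_ne_zero hk)
    have hwn : ‖w‖ = r / 2 := by
      have := congrArg norm hw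
      rw [norm_pow, norm_neg, Complex.norm_real, Real.norm_of_nonneg (by positivity)] at this
      exact (pow_left_inj₀ (norm_nonneg _) (by positivity) hk).1 this
    refine ⟨w, by simp [hwn, hr], ?_⟩
    rw [mem_ofPred_eq, hw, Complex.neg_re, Complex.ofReal_re, neg_lt_zero]
    positivity
  · rw [hinter (ε < ·)]
    refine Nonempty.image _ ?_
    simp only [hgt]
    refine ⟨((r / 2 : ℝ) : ℂ), ?_, ?_⟩
    · rw [mem_ball_zero_iff, Complex.norm_real, Real.norm_of_nonneg (by positivity)]
      linarith
    · rw [mem_ofPred_eq, ← Complex.ofReal_pow, Complex.ofReal_re]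
      positivity
  · intro hd
    obtain rfl := hk1 hd
    rw [hinter (· < ε), hinter (ε < ·)]
    simp only [hlt, hgt, pow_one]
    exact ⟨himg ((convex_ball _ _).inter (convex_halfSpace_re_lt 0)).isPreconnected,
      himg ((convex_ball _ _).inter (convex_halfSpace_re_gt 0)).isPreconnected⟩

/-! ### Level curves and their faces. -/

section LevelCurve

variable {U : Set ℂ} {f : ℂ → ℂ} {ε : ℝ} {L : Set ℂ}

theorem IsLevelCurve.subset_levelSet (hL : IsLevelCurve U f ε L) : L ⊆ levelSet U f ε := by
  obtain ⟨z, -, rfl⟩ := hL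
  exact connectedComponentIn_subset _ _

theorem IsLevelCurve.isPreconnected (hL : IsLevelCurve U f ε L) : IsPreconnected L := by
  obtain ⟨z, -, rfl⟩ := hL
  exact isPreconnected_connectedComponentIn

theorem IsLevelCurve.nonempty (hL : IsLevelCurve U f ε L) : L.Nonempty := by
  obtain ⟨z, hz, rfl⟩ := hL
  exact ⟨z, mem_connectedComponentIn hz⟩

theorem IsLevelCurve.subset_of_mem (hL : IsLevelCurve U f ε L) {S : Set ℂ} {x : ℂ}
    (hS : IsPreconnected S) (hSU : S ⊆ levelSet U f ε) (hxS : x ∈ S) (hxL : x ∈ L) : S ⊆ L := by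
  obtain ⟨z, hz, rfl⟩ := hL
  rw [connectedComponentIn_eq hxL]
  exact hS.subset_connectedComponentIn hxS hSU

theorem IsLevelCurve.analyticAt (hf : MeromorphicNFOn f U) (hε : 0 < ε)
    (hL : IsLevelCurve U f ε L) {z : ℂ} (hz : z ∈ L) : AnalyticAt ℂ f z := by
  obtain ⟨hzU, hzf⟩ := hL.subset_levelSet hz
  refine (meromorphicNFAt_iff_analyticAt_or.1 (hf hzU)).resolve_right fun h ↦ ?_
  rw [h.2.2, norm_zero] at hzf
  exact hε.ne hzf

/-- A limit point of `L` is not a pole, because `|f|` tends to infinity there; continuity then puts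
it in the level set, and adjoining it to `L` preserves connectedness. -/
theorem IsLevelCurve.isClosed (hf : MeromorphicNFOn f U) (hε : 0 < ε)
    (hL : IsLevelCurve U f ε L) (hLU : closure L ⊆ U) : IsClosed L := by
  refine isClosed_of_closure_subset fun w hw ↦ ?_
  have hfreq : ∃ᶠ z in 𝓝 w, ‖f z‖ = ε :=
    (mem_closure_iff_frequently.1 hw).mono fun z hz ↦ (hL.subset_levelSet hz).2
  have hfw : ‖f w‖ = ε := by
    rcases meromorphicNFAt_iff_analyticAt_or.1 (hf (hLU hw)) with h | ⟨-, h, hw0⟩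
    · by_contra hne
      exact hfreq (h.continuousAt.norm.eventually_ne hne)
    · exfalso
      have h1 : ∀ᶠ z in 𝓝[≠] w, ε < ‖f z‖ :=
        (tendsto_norm_cobounded_atTop.comp
          (tendsto_cobounded_of_meromorphicOrderAt_neg h)).eventually_gt_atTop ε
      refine hfreq ?_
      filter_upwards [eventually_nhdsWithin_iff.1 h1] with z hz hze
      -- At the pole itself the default value 0 differs from `ε`.
      by_cases hzw : z = w
      · rw [hzw, hw0, norm_zero] at hze
        exact hε.ne hze
      · exact (hz hzw).ne' hze
  obtain ⟨x, hx⟩ := hL.nonempty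
  exact hL.subset_of_mem (hL.isPreconnected.subset_closure (subset_insert w L)
    (insert_subset hw subset_closure)) (insert_subset ⟨hLU hw, hfw⟩ hL.subset_levelSet)
    (mem_insert_of_mem _ hx) hx (mem_insert _ _)

/-- The points of `L` where `f` is locally constant form a clopen subset of the plane: open because
a disc of constancy stays in `L`, closed by the identity theorem for `f'`. Boundedness of `L`
excludes the whole plane. -/
theorem IsLevelCurve.not_eventually_const (hU : IsOpen U) (hf : MeromorphicNFOn f U) (hε : 0 < ε)
    (hL : IsLevelCurve U f ε L) (hLc : IsClosed L) (hLb : Bornology.IsBounded L) {z : ℂ}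
    (hz : z ∈ L) : ¬ ∀ᶠ w in 𝓝 z, f w = f z := by
  intro hconst
  set T := {x | x ∈ L ∧ ∀ᶠ w in 𝓝 x, f w = f x} with hT
  have hTo : IsOpen T := by
    rw [Metric.isOpen_iff]
    rintro x ⟨hxL, hx⟩
    obtain ⟨hxU, hxf⟩ := hL.subset_levelSet hxL
    obtain ⟨r, hr, hball⟩ := Metric.eventually_nhds_iff_ball.1 (hx.and (hU.mem_nhds hxU))
    refine ⟨r, hr, fun y hy ↦ ⟨?_, ?_⟩⟩
    · refine hL.subset_of_mem (convex_ball x r).isPreconnected (fun w hw ↦ ?_)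
        (Metric.mem_ball_self hr) hxL hy
      exact ⟨(hball w hw).2, by rw [(hball w hw).1, hxf]⟩
    · filter_upwards [Metric.isOpen_ball.mem_nhds hy] with w hw
      rw [(hball w hw).1, (hball y hy).1]
  have hTc : IsClosed T := by
    refine isClosed_of_closure_subset fun x hx ↦ ?_
    by_contra hxT
    have hxL : x ∈ L := hLc.closure_subset_iff.2 (fun y hy ↦ hy.1) hx
    have ha := hL.analyticAt hf hε hxL
    have hfr : ∃ᶠ y in 𝓝[≠] x, deriv f y = 0 := by
      have : ∃ᶠ y in 𝓝[≠] x, y ∈ T := by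
        rw [frequently_nhdsWithin_iff]
        exact (mem_closure_iff_frequently.1 hx).mono fun y hy ↦
          ⟨hy, fun h ↦ hxT (mem_singleton_iff.1 h ▸ hy)⟩
      refine this.mono fun y hy ↦ ?_
      rw [EventuallyEq.deriv_eq hy.2, deriv_const]
    have hev := ha.deriv.frequently_zero_iff_eventually_zero.1 hfr
    obtain ⟨r, hr, hball⟩ := Metric.eventually_nhds_iff_ball.1
      (hev.and ha.eventually_analyticAt)
    refine hxT ⟨hxL, ?_⟩
    filter_upwards [Metric.ball_mem_nhds x hr] with y hy
    exact Metric.isOpen_ball.is_const_of_deriv_eq_zero (convex_ball x r).isPreconnected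
      (fun w hw ↦ (hball w hw).2.differentiableAt.differentiableWithinAt)
      (fun w hw ↦ (hball w hw).1) hy (Metric.mem_ball_self hr)
  rcases isClopen_iff.1 ⟨hTc, hTo⟩ with h | h
  · have : z ∈ T := ⟨hz, hconst⟩
    rwa [h] at this
  · exact NormedSpace.unbounded_univ ℝ ℂ (hLb.subset (h ▸ fun y hy ↦ hy.1))

/-- A compact level curve is isolated in its level set. -/
theorem IsLevelCurve.exists_isOpen_superset (hU : IsOpen U) (hf : MeromorphicNFOn f U)
    (hε : 0 < ε) (hL : IsLevelCurve U f ε L) (hLc : IsClosed L) (hLb : Bornology.IsBounded L) :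
    ∃ N, IsOpen N ∧ IsPreconnected N ∧ L ⊆ N ∧ ContinuousOn f N ∧
      ∀ z ∈ N, ‖f z‖ = ε → z ∈ L := by
  have key : ∀ z ∈ L, ∃ N, IsOpen N ∧ z ∈ N ∧ IsPreconnected N ∧ ContinuousOn f N ∧
      ∀ w ∈ N, ‖f w‖ = ε → w ∈ L := fun z hz ↦ by
    have ha := hL.analyticAt hf hε hz
    obtain ⟨hzU, hzf⟩ := hL.subset_levelSet hz
    obtain ⟨N, hNo, hzN, hNW, hNc, hNl, -⟩ := ha.exists_nhds_level hε hzf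
      (hL.not_eventually_const hU hf hε hLc hLb hz)
      (inter_mem (hU.mem_nhds hzU) ha.eventually_analyticAt)
    exact ⟨N, hNo, hzN, hNc,
      fun w hw ↦ (hNW hw).2.continuousAt.continuousWithinAt,
      -- The level set within the small neighbourhood is connected and contains `z`, so it lies in
      -- `L`.
      fun w hw hwf ↦ hL.subset_of_mem hNl (fun x hx ↦ ⟨(hNW hx.1).1, hx.2⟩) ⟨hzN, hzf⟩ hz
        ⟨hw, hwf⟩⟩
  choose! N hNo hzN hNc hNf hNl using key
  have hLN : L ⊆ ⋃ z ∈ L, N z := fun z hz ↦ mem_biUnion hz (hzN z hz)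
  refine ⟨⋃ z ∈ L, N z, isOpen_biUnion hNo, ?_, hLN, ?_, ?_⟩
  · obtain ⟨p, hp⟩ := hL.nonempty
    refine isPreconnected_of_forall p fun y hy ↦ ?_
    obtain ⟨z, hz, hyz⟩ := mem_iUnion₂.1 hy
    exact ⟨L ∪ N z, union_subset hLN (subset_biUnion_of_mem hz), .inl hp, .inr hyz,
      hL.isPreconnected.union z hz (hzN z hz) (hNc z hz)⟩
  · intro w hw
    obtain ⟨z, hz, hwz⟩ := mem_iUnion₂.1 hw
    exact ((hNf z hz).continuousAt ((hNo z hz).mem_nhds hwz)).continuousWithinAt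
  · intro w hw hwf
    obtain ⟨z, hz, hwz⟩ := mem_iUnion₂.1 hw
    exact hNl z hz w hwz hwf

/-- Near a compact level curve, `|f|` stays on one side of the level in each face. -/
theorem IsLevelCurve.face_one_sided {N F : Set ℂ} (hL : IsLevelCurve U f ε L) (hLc : IsClosed L)
    (hNo : IsOpen N) (hN : IsPreconnected N) (hLN : L ⊆ N) (hfN : ContinuousOn f N)
    (hNL : ∀ z ∈ N, ‖f z‖ = ε → z ∈ L) (hF : IsFace L F) {x y : ℂ} (hx : x ∈ F ∩ N)
    (hy : y ∈ F ∩ N) (hxε : ‖f x‖ < ε) (hyε : ε < ‖f y‖) : False := by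
  obtain ⟨z, hz, hzε⟩ := (hF.isPreconnected_inter hLc hL.nonempty hN hNo hLN).intermediate_value
    hx hy (hfN.norm.mono inter_subset_right) ⟨hxε.le, hyε.le⟩
  exact hF.subset_compl hz.1 (hNL z hz.2 hzε)

theorem IsLevelCurve.exists_two_faces (hU : IsOpen U) (hf : MeromorphicNFOn f U)
    (hε : 0 < ε) (hL : IsLevelCurve U f ε L) (hLc : IsClosed L) (hLb : Bornology.IsBounded L) :
    ∃ F₁ F₂, IsFace L F₁ ∧ IsFace L F₂ ∧ F₁ ≠ F₂ := by
  obtain ⟨N, hNo, hNc, hLN, hfN, hNL⟩ := hL.exists_isOpen_superset hU hf hε hLc hLb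
  obtain ⟨z, hz⟩ := hL.nonempty
  obtain ⟨M, -, -, hMN, -, -, ⟨x, hxM, hx⟩, ⟨y, hyM, hy⟩, -⟩ :=
    (hL.analyticAt hf hε hz).exists_nhds_level hε (hL.subset_levelSet hz).2
      (hL.not_eventually_const hU hf hε hLc hLb hz) (hNo.mem_nhds (hLN hz))
  obtain ⟨F₁, hF₁, hxF⟩ := exists_isFace_mem (L := L) (z := x)
    fun h ↦ hx.ne (hL.subset_levelSet h).2
  obtain ⟨F₂, hF₂, hyF⟩ := exists_isFace_mem (L := L) (z := y)
    fun h ↦ hy.ne' (hL.subset_levelSet h).2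
  refine ⟨F₁, F₂, hF₁, hF₂, ?_⟩
  rintro rfl
  exact hL.face_one_sided hLc hNo hNc hLN hfN hNL hF₁ ⟨hxF, hMN hxM⟩ ⟨hyF, hMN hyM⟩ hx hy

/-- Near a noncritical point, a compact level curve separates exactly two faces. -/
theorem IsLevelCurve.exists_nhds_two_faces (hU : IsOpen U) (hf : MeromorphicNFOn f U)
    (hε : 0 < ε) (hL : IsLevelCurve U f ε L) (hLc : IsClosed L) (hLb : Bornology.IsBounded L)
    {z : ℂ} (hz : z ∈ L) (hd : deriv f z ≠ 0) :
    ∃ M F₁ F₂, IsOpen M ∧ z ∈ M ∧ IsFace L F₁ ∧ IsFace L F₂ ∧ F₁ ≠ F₂ ∧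
      L ∩ M ⊆ frontier F₁ ∧ L ∩ M ⊆ frontier F₂ ∧
      ∀ F, IsFace L F → (F ∩ M).Nonempty → F = F₁ ∨ F = F₂ := by
  obtain ⟨N, hNo, hNc, hLN, hfN, hNL⟩ := hL.exists_isOpen_superset hU hf hε hLc hLb
  have hnhds : ∀ w ∈ L, ∀ W ∈ 𝓝 w, _ := fun w hw W hW ↦
    (hL.analyticAt hf hε hw).exists_nhds_level hε (hL.subset_levelSet hw).2
      (hL.not_eventually_const hU hf hε hLc hLb hw) hW
  obtain ⟨M, hMo, hzM, hMN, -, -, ⟨x, hxM, hx⟩, ⟨y, hyM, hy⟩, hM⟩ :=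
    hnhds z hz N (hNo.mem_nhds (hLN hz))
  obtain ⟨hA, hB⟩ := hM hd
  have hAL : M ∩ {z | ‖f z‖ < ε} ⊆ Lᶜ := fun w hw h ↦ hw.2.ne (hL.subset_levelSet h).2
  have hBL : M ∩ {z | ε < ‖f z‖} ⊆ Lᶜ := fun w hw h ↦ hw.2.ne' (hL.subset_levelSet h).2
  obtain ⟨F₁, hF₁, hxF⟩ := exists_isFace_mem (hAL ⟨hxM, hx⟩)
  obtain ⟨F₂, hF₂, hyF⟩ := exists_isFace_mem (hBL ⟨hyM, hy⟩)
  have hAF := hF₁.subset_of_inter_nonempty hA hAL ⟨x, hxF, hxM, hx⟩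
  have hBF := hF₂.subset_of_inter_nonempty hB hBL ⟨y, hyF, hyM, hy⟩
  have hfr : ∀ F, IsFace L F → (∀ w ∈ L ∩ M, w ∈ closure F) → L ∩ M ⊆ frontier F := by
    intro F hF h w hw
    rw [(hF.isOpen hLc).frontier_eq]
    exact ⟨h w hw, fun hwF ↦ hF.subset_compl hwF hw.1⟩
  refine ⟨M, F₁, F₂, hMo, hzM, hF₁, hF₂, ?_, hfr F₁ hF₁ ?_, hfr F₂ hF₂ ?_, ?_⟩
  · rintro rfl
    exact hL.face_one_sided hLc hNo hNc hLN hfN hNL hF₁ ⟨hxF, hMN hxM⟩ ⟨hyF, hMN hyM⟩ hx hy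
  -- Points with `|f| < ε` accumulate at every point of `L`, critical or not, and inside `M` they
  -- all belong to `F₁`.
  · rintro w ⟨hwL, hwM⟩
    refine mem_closure_iff_nhds.2 fun W hW ↦ ?_
    obtain ⟨M', -, -, hM', -, -, ⟨p, hpM, hp⟩, -⟩ :=
      hnhds w hwL (W ∩ M) (inter_mem hW (hMo.mem_nhds hwM))
    exact ⟨p, (hM' hpM).1, hAF ⟨(hM' hpM).2, hp⟩⟩
  · rintro w ⟨hwL, hwM⟩
    refine mem_closure_iff_nhds.2 fun W hW ↦ ?_
    obtain ⟨M', -, -, hM', -, -, -, ⟨p, hpM, hp⟩, -⟩ :=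
      hnhds w hwL (W ∩ M) (inter_mem hW (hMo.mem_nhds hwM))
    exact ⟨p, (hM' hpM).1, hBF ⟨(hM' hpM).2, hp⟩⟩
  · rintro F hF ⟨p, hpF, hpM⟩
    rcases lt_trichotomy ‖f p‖ ε with h | h | h
    · exact .inl (hF.eq_of_inter_nonempty hF₁ ⟨p, hpF, hAF ⟨hpM, h⟩⟩)
    · exact absurd (hNL p (hMN hpM) h) (hF.subset_compl hpF)
    · exact .inr (hF.eq_of_inter_nonempty hF₂ ⟨p, hpF, hBF ⟨hpM, h⟩⟩)

/-- Along the vertex-free part `E` of the edge, lying on the frontier of a given face is both a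
closed and, by the local two-face picture, an open condition. So the faces adjacent to the edge are
the two seen at one point of `E`. -/
theorem IsLevelCurve.encard_adjacent_faces (hU : IsOpen U) (hf : MeromorphicNFOn f U)
    (hε : 0 < ε) (hL : IsLevelCurve U f ε L) (hLc : IsClosed L) (hLb : Bornology.IsBounded L)
    {e : Set ℂ} (he : IsLevelCurveEdge f L e) :
    {F : Set ℂ | IsFace L F ∧ IsAdjacent e F}.encard = 2 := by
  obtain ⟨z, hz, rfl⟩ := he
  have hd : ∀ w ∈ L \ levelCurveVertices f L, deriv f w ≠ 0 := fun w hw h ↦ hw.2 ⟨hw.1, h⟩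
  have hEL := connectedComponentIn_subset (L \ levelCurveVertices f L) z
  have hzE := mem_connectedComponentIn hz
  have hEc := isPreconnected_connectedComponentIn (F := L \ levelCurveVertices f L) (x := z)
  set E := connectedComponentIn (L \ levelCurveVertices f L) z
  have hmeets : ∀ F M : Set ℂ, IsOpen M → ∀ w ∈ M, w ∈ frontier F → (F ∩ M).Nonempty :=
    fun F M hM w hw hwF ↦ by
      rw [inter_comm]
      exact mem_closure_iff.1 (frontier_subset_closure hwF) M hM hw
  have hspread : ∀ F, IsFace L F → z ∈ frontier F → closure E ⊆ frontier F := by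
    intro F hF hzF
    refine closure_minimal ?_ isClosed_frontier
    have hloc : ∀ w ∈ E ∩ frontier F, ∃ M, IsOpen M ∧ w ∈ M ∧ L ∩ M ⊆ frontier F := by
      rintro w ⟨hwE, hwF⟩
      obtain ⟨M, F₁, F₂, hMo, hwM, -, -, -, h1, h2, h⟩ :=
        hL.exists_nhds_two_faces hU hf hε hLc hLb (hEL hwE).1 (hd w (hEL hwE))
      refine ⟨M, hMo, hwM, ?_⟩
      rcases h F hF (hmeets F M hMo w hwM hwF) with rfl | rfl
      exacts [h1, h2]
    choose! M hMo hwM hMF using hloc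
    intro x hxE
    by_contra hxF
    obtain ⟨y, hyE, hyM, hyF⟩ := hEc (⋃ w ∈ E ∩ frontier F, M w) (frontier F)ᶜ
      (isOpen_biUnion hMo) isClosed_frontier.isOpen_compl
      (fun w hw ↦ (em (w ∈ frontier F)).imp (fun h ↦ mem_biUnion ⟨hw, h⟩ (hwM w ⟨hw, h⟩)) id)
      ⟨z, hzE, mem_biUnion ⟨hzE, hzF⟩ (hwM z ⟨hzE, hzF⟩)⟩ ⟨x, hxE, hxF⟩
    obtain ⟨w, hw, hyw⟩ := mem_iUnion₂.1 hyM
    exact hyF (hMF w hw ⟨(hEL hyE).1, hyw⟩)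
  obtain ⟨M, F₁, F₂, hMo, hzM, hF₁, hF₂, hne, h1, h2, h⟩ :=
    hL.exists_nhds_two_faces hU hf hε hLc hLb hz.1 (hd z hz)
  have : {F : Set ℂ | IsFace L F ∧ IsAdjacent (closure E) F} = {F₁, F₂} := by
    ext F
    constructor
    · rintro ⟨hF, hEF⟩
      exact h F hF (hmeets F M hMo z hzM (hEF (subset_closure hzE)))
    · rintro (rfl | rfl)
      · exact ⟨hF₁, hspread _ hF₁ (h1 ⟨hz.1, hzM⟩)⟩
      · exact ⟨hF₂, hspread _ hF₂ (h2 ⟨hz.1, hzM⟩)⟩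
  rw [this, encard_pair hne]

end LevelCurve

end

theorem mainTheorem7 (G U : Set ℂ) (hG : IsOpen G) (hU : IsOpen U) (hGU : closure G ⊆ U)
    (f : ℂ → ℂ) (hf : MeromorphicNFOn f U) (ε : ℝ) (hε : 0 < ε)
    (L : Set ℂ) (hL : IsLevelCurve U f ε L) (hLb : Bornology.IsBounded L) (hLG : L ⊆ G) :
    (∃! F : Set ℂ, IsFace L F ∧ ¬ Bornology.IsBounded F) ∧
    (∃ F : Set ℂ, IsFace L F ∧ Bornology.IsBounded F) ∧
    (∀ e : Set ℂ, IsLevelCurveEdge f L e →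
      {F : Set ℂ | IsFace L F ∧ IsAdjacent e F}.encard = 2) := by
  have hLc : IsClosed L := hL.isClosed hf hε ((closure_mono hLG).trans hGU)
  have hunb := existsUnique_isFace_not_isBounded hLb
  refine ⟨hunb, ?_, fun e he ↦ hL.encard_adjacent_faces hU hf hε hLc hLb he⟩
  obtain ⟨F₁, F₂, hF₁, hF₂, hne⟩ := hL.exists_two_faces hU hf hε hLc hLb
  -- If no face were bounded, two distinct faces would both be the unbounded one.
  by_contra! hall
  exact hne (hunb.unique ⟨hF₁, hall F₁ hF₁⟩ ⟨hF₂, hall F₂ hF₂⟩)
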